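/- Let $G$ be a connected simple graph, not necessarily finite, and let $r \ge 0$ be an integer. A walk may be reduced by replacing a subwalk $u\,e\,v\,e\,u$ with the trivial walk $u$; two walks are homotopic if they have the same reduction, and $\pi_1(G,x)$ is the group of closed walks of $G$ at the vertex $x$ up to homotopy, under concatenation. The $r$-local subgroup $\pi_1^r(G,x)$ of $\pi_1(G,x)$ is the subgroup generated by the classes of all closed walks $W_0QW_0^-$ at $x$, where $Q$ is a closed walk once around a cycle of $G$ of length at most $r$, $W_0$ is a walk from $x$ to the first vertex of $Q$, and $W_0^-$ is its reverse. The $r$-local covering $p_r\colon G_r\to G$ is the covering of $G$ by a connected graph $G_r$, unique up to isomorphism, such that $p_r$ induces an isomorphism from $\pi_1(G_r,\hat x)$ to $\pi_1^r(G,x)$, where $\hat x$ is a lift of a vertex $x$ of $G$. The displacement of $p_r$ is $$\Delta_r(G) := \min\{\operatorname{dist}_{G_r}(\hat u,\hat v) : \hat u \ne \hat v,\ p_r(\hat u)=p_r(\hat v)\},$$ with $\min\emptyset=\infty$. Then $\Delta_r(G)$ is at least the minimum of the lengths of those induced cycles of $G$ whose length is greater than $r$ (where this minimum is $\infty$ if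 there is no such cycle). -/

import Mathlib

namespace LocalCov

open SimpleGraph

variable {V : Type*} {G : SimpleGraph V}

/-! ### Homotopy of walks and the combinatorial fundamental group -/

/-- Elementary reduction: a subwalk `u e v e u` is replaced with the trivial walk `u`. -/
inductive ReductionStep {x y : V} : G.Walk x y → G.Walk x y → Prop
  | backtrack {u v : V} (p : G.Walk x u) (h : G.Adj u v) (q : G.Walk u y) :
      ReductionStep (p.append (.cons h (.cons h.symm q))) (p.append q)

/-- Two walks are homotopic if elementary reductions, applied in either direction, lead from one
to the other; equivalently, if they have the same reduction. -/
def Homotopic {x y : V} : G.Walk x y → G.Walk x y → Prop :=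
  Relation.EqvGen ReductionStep

theorem Homotopic.equivalence (x y : V) :
    Equivalence (Homotopic : G.Walk x y → G.Walk x y → Prop) :=
  Relation.EqvGen.is_equivalence _

theorem Homotopic.append_left {x y z : V} (p : G.Walk x y) {q q' : G.Walk y z}
    (h : Homotopic q q') : Homotopic (p.append q) (p.append q') := by
  induction h with
  | rel a b hab =>
    cases hab with
    | backtrack s h t =>
      rw [Walk.append_assoc, Walk.append_assoc]
      exact .rel _ _ (.backtrack (p.append s) h t)
  | refl a => exact .refl _
  | symm a b _ ih => exact .symm _ _ ih
  | trans a b c _ _ ih ih' => exact .trans _ _ _ ih ih'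

theorem Homotopic.append_right {x y z : V} {p p' : G.Walk x y} (h : Homotopic p p')
    (q : G.Walk y z) : Homotopic (p.append q) (p'.append q) := by
  induction h with
  | rel a b hab =>
    cases hab with
    | backtrack s h t =>
      rw [← Walk.append_assoc, ← Walk.append_assoc, Walk.cons_append, Walk.cons_append]
      exact .rel _ _ (.backtrack s h (t.append q))
  | refl a => exact .refl _
  | symm a b _ ih => exact .symm _ _ ih
  | trans a b c _ _ ih ih' => exact .trans _ _ _ ih ih'

theorem Homotopic.append {x y z : V} {p p' : G.Walk x y} {q q' : G.Walk y z}
    (h : Homotopic p p') (h' : Homotopic q q') : Homotopic (p.append q) (p'.append q') :=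
  .trans _ _ _ (h.append_right q) (h'.append_left p')

theorem Homotopic.reverse {x y : V} {p p' : G.Walk x y} (h : Homotopic p p') :
    Homotopic p.reverse p'.reverse := by
  induction h with
  | rel a b hab =>
    cases hab with
    | backtrack s h t =>
      have := ReductionStep.backtrack t.reverse h s.reverse
      refine .rel _ _ ?_
      simpa [Walk.reverse_append, ← Walk.append_assoc] using this
  | refl a => exact .refl _
  | symm a b _ ih => exact .symm _ _ ih
  | trans a b c _ _ ih ih' => exact .trans _ _ _ ih ih'

theorem Homotopic.append_reverse_self {x y : V} (p : G.Walk x y) :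
    Homotopic (p.append p.reverse) .nil := by
  induction p with
  | nil => exact .refl _
  | cons h p ih =>
    have h1 := (ih.append_right (Walk.cons h.symm Walk.nil)).append_left (Walk.cons h Walk.nil)
    have h2 := Homotopic.equivalence (G := G) _ _ |>.trans h1
      (.rel _ _ (ReductionStep.backtrack .nil h .nil))
    simpa [← Walk.append_assoc] using h2

theorem Homotopic.reverse_append_self {x y : V} (p : G.Walk x y) :
    Homotopic (p.reverse.append p) .nil := by
  simpa using Homotopic.append_reverse_self p.reverse

theorem Homotopic.map {W : Type*} {H : SimpleGraph W} (f : H →g G) {x y : W}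
    {p p' : H.Walk x y} (h : Homotopic p p') : Homotopic (p.map f) (p'.map f) := by
  induction h with
  | rel a b hab =>
    cases hab with
    | backtrack s h t =>
      rw [Walk.map_append, Walk.map_append]
      exact .rel _ _ (.backtrack (s.map f) (f.map_adj h) (t.map f))
  | refl a => exact .refl _
  | symm a b _ ih => exact .symm _ _ ih
  | trans a b c _ _ ih ih' => exact .trans _ _ _ ih ih'

/-- Homotopy of closed walks at `x`. -/
def homotopySetoid (G : SimpleGraph V) (x : V) : Setoid (G.Walk x x) :=
  ⟨Homotopic, Homotopic.equivalence x x⟩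

/-- The combinatorial fundamental group of `G` at `x`: closed walks at `x` up to homotopy. -/
def FundGroup (G : SimpleGraph V) (x : V) : Type _ :=
  Quotient (homotopySetoid G x)

/-- The homotopy class of a closed walk. -/
def FundGroup.mk {x : V} (w : G.Walk x x) : FundGroup G x :=
  Quotient.mk (homotopySetoid G x) w

theorem FundGroup.sound {x : V} {w w' : G.Walk x x} (h : Homotopic w w') :
    FundGroup.mk w = FundGroup.mk w' :=
  Quotient.sound h

/-- Multiplication is concatenation of walks, inversion is reversal. -/
instance (x : V) : Group (FundGroup G x) where
  mul := Quotient.map₂ (fun p q => p.append q) fun _ _ h _ _ h' => Homotopic.append h h'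
  one := FundGroup.mk .nil
  inv := Quotient.map (fun p => p.reverse) fun _ _ h => Homotopic.reverse h
  mul_assoc := by
    rintro ⟨a⟩ ⟨b⟩ ⟨c⟩
    exact congrArg FundGroup.mk (Walk.append_assoc a b c).symm
  one_mul := by
    rintro ⟨a⟩
    exact congrArg FundGroup.mk (Walk.nil_append a)
  mul_one := by
    rintro ⟨a⟩
    exact congrArg FundGroup.mk (Walk.append_nil a)
  inv_mul_cancel := by
    rintro ⟨a⟩
    exact FundGroup.sound (Homotopic.reverse_append_self a)

theorem FundGroup.mk_append {x : V} (p q : G.Walk x x) :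
    FundGroup.mk (p.append q) = FundGroup.mk p * FundGroup.mk q := rfl

theorem FundGroup.mk_reverse {x : V} (p : G.Walk x x) :
    FundGroup.mk p.reverse = (FundGroup.mk p)⁻¹ := rfl

theorem FundGroup.mk_nil {x : V} : FundGroup.mk (.nil : G.Walk x x) = 1 := rfl

/-- The homomorphism of fundamental groups that a graph homomorphism induces. -/
def FundGroup.map {W : Type*} {H : SimpleGraph W} (f : H →g G) (x : W) :
    FundGroup H x →* FundGroup G (f x) where
  toFun := Quotient.map (fun p => p.map f) fun _ _ h => Homotopic.map f h
  map_one' := rfl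
  map_mul' := by
    rintro ⟨a⟩ ⟨b⟩
    exact congrArg FundGroup.mk (Walk.map_append f a b)

/-! ### The local subgroup, coverings, local coverings -/

/-- The closed walk `w` stems from the closed walk `q` if `w = w₀ q w₀⁻`. -/
def StemsFrom {x y : V} (w : G.Walk x x) (q : G.Walk y y) : Prop :=
  ∃ w₀ : G.Walk x y, w = w₀.append (q.append w₀.reverse)

/-- The `r`-local subgroup of the fundamental group: it is generated by the closed walks that stem
from a cycle of length at most `r`. (`q.IsCycle` says that `q` is a closed walk once around a
cycle.) -/
def localSubgroup (G : SimpleGraph V) (r : ℕ) (x : V) : Subgroup (FundGroup G x) :=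
  Subgroup.closure {g | ∃ (w : G.Walk x x) (y : V) (q : G.Walk y y),
    q.IsCycle ∧ q.length ≤ r ∧ StemsFrom w q ∧ g = FundGroup.mk w}

/-- A covering: a surjective homomorphism that, for every vertex `v`, maps the edges at `v`
bijectively to the edges at the image of `v`. In a simple graph the edges at `v` correspond to the
neighbours of `v`; surjectivity on edges follows. -/
structure IsCovering {C : Type*} {K : SimpleGraph C} (p : K →g G) : Prop where
  surjective : Function.Surjective p
  bijOn : ∀ v : C, Set.BijOn p (K.neighborSet v) (G.neighborSet (p v))

/-- `p : K → G` is the `r`-local covering of `G`: a covering by a connected graph whose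
characteristic subgroup is the `r`-local subgroup, at some lift `c` of a vertex of `G`.
(A covering always induces an injection of fundamental groups, so this says that it induces an
isomorphism onto the `r`-local subgroup.) -/
structure IsLocalCovering {C : Type*} {K : SimpleGraph C} (r : ℕ) (p : K →g G) : Prop where
  connected : K.Connected
  isCovering : IsCovering p
  range_eq : ∃ c : C, (FundGroup.map p c).range = localSubgroup G r (p c)

/-- The least distance between two distinct lifts of the same vertex, `⊤` if there are none. For
the `r`-local covering `p` of `G` this is the displacement `Δ_r(G)`. -/
noncomputable def displacement {C : Type*} {K : SimpleGraph C} (p : K →g G) : ℕ∞ :=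
  ⨅ (u : C) (v : C) (_ : u ≠ v ∧ p u = p v), K.edist u v

/-- The minimum length of an induced cycle of `G` that is longer than `r`, `⊤` if there is
none. -/
noncomputable def minLongInducedCycle (G : SimpleGraph V) (r : ℕ) : ℕ∞ :=
  ⨅ (x : V) (q : G.Walk x x) (_ : q.IsCycle ∧ q.IsChordless ∧ r < q.length), (q.length : ℕ∞)

/-! ### The `r`-local covering exists -/

/-- Walks from `x` to `y`, identified if they differ by an element of the `r`-local subgroup. -/
def coverSetoid (G : SimpleGraph V) (r : ℕ) (x y : V) : Setoid (G.Walk x y) where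
  r w w' := FundGroup.mk (w.append w'.reverse) ∈ localSubgroup G r x
  iseqv := by
    refine ⟨fun w => ?_, fun {w w'} h => ?_, fun {a b c} h h' => ?_⟩
    · rw [FundGroup.sound (Homotopic.append_reverse_self w)]
      exact one_mem _
    · have := inv_mem h
      rwa [← FundGroup.mk_reverse, Walk.reverse_append, Walk.reverse_reverse] at this
    · have := mul_mem h h'
      rw [← FundGroup.mk_append, ← Walk.append_assoc, Walk.append_assoc b.reverse] at this
      rwa [FundGroup.sound (Homotopic.append_left a
        ((Homotopic.reverse_append_self b).append_right c.reverse)), Walk.nil_append] at this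

/-- The vertices of the `r`-local covering of `G` constructed from the base point `x`. -/
def CoverVertex (G : SimpleGraph V) (r : ℕ) (x : V) : Type _ :=
  Σ y : V, Quotient (coverSetoid G r x y)

/-- The lift of the end of the walk `w` that is reached by lifting `w`. -/
def CoverVertex.of (r : ℕ) {x y : V} (w : G.Walk x y) : CoverVertex G r x :=
  ⟨y, Quotient.mk _ w⟩

theorem CoverVertex.of_eq_iff {r : ℕ} {x y : V} {w w' : G.Walk x y} :
    CoverVertex.of r w = CoverVertex.of r w' ↔
      FundGroup.mk (w.append w'.reverse) ∈ localSubgroup G r x := by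
  refine ⟨fun h => ?_, fun h => ?_⟩
  · exact Quotient.exact (s := coverSetoid G r x y) (eq_of_heq (Sigma.mk.inj h).2)
  · exact congrArg (Sigma.mk y) (Quotient.sound (s := coverSetoid G r x y) h)

theorem CoverVertex.exists_rep {r : ℕ} {x : V} (c : CoverVertex G r x) :
    ∃ w : G.Walk x c.1, CoverVertex.of r w = c := by
  obtain ⟨y, ⟨w⟩⟩ := c
  exact ⟨w, rfl⟩

theorem CoverVertex.of_homotopic {r : ℕ} {x y : V} {w w' : G.Walk x y} (h : Homotopic w w') :
    CoverVertex.of r w = CoverVertex.of r w' := by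
  rw [of_eq_iff, FundGroup.sound (h.append_right w'.reverse),
    FundGroup.sound (Homotopic.append_reverse_self w')]
  exact one_mem _

theorem CoverVertex.of_append {r : ℕ} {x y z : V} {w w' : G.Walk x y}
    (h : CoverVertex.of r w = CoverVertex.of r w') (q : G.Walk y z) :
    CoverVertex.of r (w.append q) = CoverVertex.of r (w'.append q) := by
  rw [of_eq_iff] at h ⊢
  rw [Walk.reverse_append, ← Walk.append_assoc, Walk.append_assoc q]
  rwa [FundGroup.sound (Homotopic.append_left w
    ((Homotopic.append_reverse_self q).append_right w'.reverse)), Walk.nil_append]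

theorem CoverVertex.of_concat_concat {r : ℕ} {x y z : V} (w : G.Walk x y) (h : G.Adj y z) :
    CoverVertex.of r ((w.concat h).concat h.symm) = CoverVertex.of r w := by
  have := CoverVertex.of_homotopic (r := r) (Relation.EqvGen.rel _ _
    (ReductionStep.backtrack w h .nil))
  rwa [Walk.append_nil, show w.append (.cons h (.cons h.symm .nil)) =
    (w.concat h).concat h.symm by simp [Walk.concat_eq_append, ← Walk.append_assoc]] at this

/-- The graph of the `r`-local covering. -/
def coverGraph (G : SimpleGraph V) (r : ℕ) (x : V) : SimpleGraph (CoverVertex G r x) where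
  Adj c d := ∃ (y z : V) (w : G.Walk x y) (h : G.Adj y z),
    c = CoverVertex.of r w ∧ d = CoverVertex.of r (w.concat h)
  symm := ⟨by
    rintro _ _ ⟨y, z, w, h, rfl, rfl⟩
    exact ⟨z, y, w.concat h, h.symm, rfl, (CoverVertex.of_concat_concat w h).symm⟩⟩
  loopless := ⟨by
    rintro _ ⟨y, z, w, h, rfl, h'⟩
    exact h.ne (congrArg Sigma.fst h')⟩

/-- The projection of the `r`-local covering. -/
def coverMap (G : SimpleGraph V) (r : ℕ) (x : V) : coverGraph G r x →g G where
  toFun c := c.1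
  map_rel' := by
    rintro _ _ ⟨y, z, w, h, rfl, rfl⟩
    exact h

theorem coverGraph_adj_concat {r : ℕ} {x y z : V} (w : G.Walk x y) (h : G.Adj y z) :
    (coverGraph G r x).Adj (.of r w) (.of r (w.concat h)) :=
  ⟨y, z, w, h, rfl, rfl⟩

theorem coverGraph_adj_of {r : ℕ} {x y : V} {w : G.Walk x y} {d : CoverVertex G r x}
    (h : (coverGraph G r x).Adj (.of r w) d) :
    ∃ h' : G.Adj y d.1, d = .of r (w.concat h') := by
  obtain ⟨y', z, w', h', hc, rfl⟩ := h
  obtain rfl : y = y' := congrArg Sigma.fst hc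
  have key : CoverVertex.of r (w.concat h') = CoverVertex.of r (w'.concat h') := by
    rw [Walk.concat_eq_append, Walk.concat_eq_append]
    exact CoverVertex.of_append hc _
  exact ⟨h', key.symm⟩

theorem exists_lift {r : ℕ} {x y z : V} (q : G.Walk y z) (w : G.Walk x y) (w' : G.Walk x z)
    (hw : w' = w.append q) :
    ∃ l : (coverGraph G r x).Walk (.of r w) (.of r w'), l.map (coverMap G r x) = q := by
  induction q with
  | nil =>
    rw [Walk.append_nil] at hw
    subst hw
    exact ⟨.nil, rfl⟩
  | cons h q ih =>
    obtain ⟨l, hl⟩ := ih (w.concat h) w' (by rw [hw, Walk.concat_append])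
    exact ⟨.cons (coverGraph_adj_concat w h) l, congrArg (Walk.cons h) hl⟩

theorem end_of_lift {r : ℕ} {x : V} {c d : CoverVertex G r x} (l : (coverGraph G r x).Walk c d)
    (w : G.Walk x c.1) (hw : CoverVertex.of r w = c) :
    CoverVertex.of r (w.append (l.map (coverMap G r x))) = d := by
  induction l with
  | nil => exact (congrArg _ (Walk.append_nil w)).trans hw
  | @cons c e d h l ih =>
    rw [← hw] at h
    obtain ⟨h', he⟩ := coverGraph_adj_of h
    have h2 := ih (w.concat h') he.symm
    have h3 : (w.concat h').append (l.map (coverMap G r x)) =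
        w.append (.cons h' (l.map (coverMap G r x))) := Walk.concat_append _ _ _
    exact (congrArg (CoverVertex.of r) h3).symm.trans h2

/-- The `r`-local covering of a connected graph exists. -/
theorem exists_isLocalCovering (hG : G.Connected) (r : ℕ) (x : V) :
    IsLocalCovering r (coverMap G r x) where
  connected := by
    have key : ∀ c, (coverGraph G r x).Reachable (.of r .nil) c := fun c => by
      obtain ⟨w, hw⟩ := c.exists_rep
      obtain ⟨l, -⟩ := exists_lift (r := r) w .nil w rfl
      rw [← hw]
      exact ⟨l⟩
    have : Nonempty (CoverVertex G r x) := ⟨.of r .nil⟩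
    exact ⟨fun c d => (key c).symm.trans (key d)⟩
  isCovering := by
    refine ⟨fun y => ?_, fun c => ⟨?_, ?_, ?_⟩⟩
    · obtain ⟨w⟩ := hG.preconnected x y
      exact ⟨.of r w, rfl⟩
    · exact fun d hd => (coverMap G r x).map_adj hd
    · intro d hd e he hde
      obtain ⟨w, hw⟩ := c.exists_rep
      rw [← hw, mem_neighborSet] at hd he
      obtain ⟨h, hd⟩ := coverGraph_adj_of hd
      obtain ⟨h', he⟩ := coverGraph_adj_of he
      obtain ⟨d₁, d₂⟩ := d
      obtain ⟨e₁, e₂⟩ := e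
      obtain rfl : d₁ = e₁ := hde
      exact hd.trans he.symm
    · intro y hy
      obtain ⟨w, hw⟩ := c.exists_rep
      refine ⟨.of r (w.concat hy), ?_, rfl⟩
      have := coverGraph_adj_concat (r := r) w hy
      rwa [hw] at this
  range_eq := by
    refine ⟨.of r .nil, ?_⟩
    ext g
    constructor
    · rintro ⟨⟨l⟩, rfl⟩
      have h1 := (end_of_lift l .nil rfl).symm
      have h2 := CoverVertex.of_eq_iff.mp h1
      exact (inv_mem_iff (x := FundGroup.mk (l.map (coverMap G r x)))).mp h2
    · obtain ⟨w⟩ := g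
      intro hw
      change G.Walk x x at w
      have hw' : CoverVertex.of r w = .of r .nil := by
        refine CoverVertex.of_eq_iff.mpr ?_
        rw [Walk.reverse_nil, Walk.append_nil]
        exact hw
      obtain ⟨l, hl⟩ := exists_lift (r := r) w .nil w rfl
      refine ⟨FundGroup.mk (l.copy rfl hw'), congrArg FundGroup.mk ?_⟩
      exact (Walk.map_copy (coverMap G r x) l rfl hw').trans hl

end LocalCov

namespace LocalCov

open SimpleGraph

/-! ### Closed subwalks of walks that are not paths or cycles -/

section WalkDecomposition

variable {V : Type*} {G : SimpleGraph V}

/-! A shortest walk between two distinct lifts of a vertex projects to a closed walk of the same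
length with a non-closed lift. Among all closed walks of `G` with a non-closed lift, a shortest one
is an induced cycle longer than `r`. It is a cycle: trivial walks and backtracks have only closed
lifts, and if a proper nontrivial closed subwalk can be cut out, then either it or what remains has
a non-closed lift. It is induced: a chord splits it into two shorter closed walks, and if both had
only closed lifts, so would the whole (`IsCovering.exists_shorter_of_chord`). It is longer than `r`:
a cycle of length at most `r` represents, up to conjugation, an element of the characteristic
subgroup, so its lifts close up (`IsLocalCovering.eq_of_liftsTo`). The minimality argument is run as
a strong induction on length in `IsLocalCovering.minLongInducedCycle_le`. -/

theorem exists_eq_append_append_of_not_isPath {y z : V} {q : G.Walk y z} (hq : ¬ q.IsPath) :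
    ∃ (u : V) (s : G.Walk y u) (c : G.Walk u u) (t : G.Walk u z),
      q = s.append (c.append t) ∧ 0 < c.length := by
  induction q with
  | nil => exact absurd Walk.IsPath.nil hq
  | @cons y v z h q ih =>
    by_cases hp : q.IsPath
    · have hy : y ∈ q.support := by
        by_contra hy
        exact hq ((Walk.cons_isPath_iff h q).mpr ⟨hp, hy⟩)
      obtain ⟨c, t, rfl⟩ := Walk.mem_support_iff_exists_append.mp hy
      exact ⟨y, .nil, .cons h c, t, by simp, by simp⟩
    · obtain ⟨u, s, c, t, rfl, hc⟩ := ih hp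
      exact ⟨u, .cons h s, c, t, by simp, hc⟩

/-- Two vertices of a walk split it into three subwalks, in one of the two possible orders. -/
theorem exists_eq_append_append_of_mem_support {y z u v : V} {q : G.Walk y z}
    (hu : u ∈ q.support) (hv : v ∈ q.support) :
    (∃ (s : G.Walk y u) (c : G.Walk u v) (t : G.Walk v z), q = s.append (c.append t)) ∨
      ∃ (s : G.Walk y v) (c : G.Walk v u) (t : G.Walk u z), q = s.append (c.append t) := by
  obtain ⟨s, t, rfl⟩ := Walk.mem_support_iff_exists_append.mp hu
  rcases (Walk.mem_support_append_iff s t).mp hv with hv | hv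
  · obtain ⟨s, c, rfl⟩ := Walk.mem_support_iff_exists_append.mp hv
    exact .inr ⟨s, c, t, Walk.append_assoc _ _ _ |>.symm⟩
  · obtain ⟨c, t, rfl⟩ := Walk.mem_support_iff_exists_append.mp hv
    exact .inl ⟨s, c, t, rfl⟩

/-- If a closed walk is not a cycle, then it is trivial, or goes back and forth along an edge, or
has a proper nontrivial closed subwalk. -/
theorem eq_nil_or_backtrack_or_exists_of_not_isCycle {x : V} {q : G.Walk x x}
    (hq : ¬ q.IsCycle) :
    q = .nil ∨ (∃ (v : V) (h : G.Adj x v), q = .cons h (.cons h.symm .nil)) ∨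
      ∃ (u : V) (s : G.Walk x u) (c : G.Walk u u) (t : G.Walk u x),
        q = s.append (c.append t) ∧ 0 < c.length ∧ 0 < s.length + t.length := by
  cases q with
  | nil => exact .inl rfl
  | @cons _ v _ h q =>
    refine .inr ?_
    rw [Walk.cons_isCycle_iff, not_and, not_not] at hq
    by_cases hp : q.IsPath
    · left
      -- A path from `v` to `x` that uses the edge `xv` is that edge alone, since using it later
      -- would revisit `v`.
      have he := hq hp
      cases q with
      | nil => simp at he
      | @cons _ w _ h' q =>
        obtain ⟨hp', hv⟩ := (Walk.cons_isPath_iff h' q).mp hp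
        rw [Walk.edges_cons, List.mem_cons] at he
        rcases he with he | he
        · obtain rfl : x = w := by
            rcases Sym2.eq_iff.mp he with ⟨rfl, rfl⟩ | ⟨rfl, -⟩ <;> rfl
          obtain rfl := (Walk.isPath_iff_nil.mp hp').eq_nil
          exact ⟨v, h, rfl⟩
        · exact absurd (q.snd_mem_support_of_mem_edges he) hv
    · right
      obtain ⟨u, s, c, t, rfl, hc⟩ := exists_eq_append_append_of_not_isPath hp
      exact ⟨u, .cons h s, c, t, by simp, hc, by simp⟩

end WalkDecomposition

/-! ### Lifting walks along a covering -/

section Lifting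

variable {V C : Type*} {G : SimpleGraph V} {K : SimpleGraph C} {p : K →g G}

/-- The walk `q` has a lift along `p` from `a` to `b`. -/
def LiftsTo (p : K →g G) : ∀ {y z : V}, G.Walk y z → C → C → Prop
  | y, _, .nil, a, b => p a = y ∧ a = b
  | y, _, .cons _ q, a, b => p a = y ∧ ∃ m, K.Adj a m ∧ LiftsTo p q m b

theorem LiftsTo.map_start {y z : V} {q : G.Walk y z} {a b : C} (h : LiftsTo p q a b) :
    p a = y := by
  cases q <;> exact h.1

theorem LiftsTo.map_end {y z : V} {q : G.Walk y z} {a b : C} (h : LiftsTo p q a b) :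
    p b = z := by
  induction q generalizing a with
  | nil => exact h.2 ▸ h.1
  | cons _ _ ih =>
    obtain ⟨-, m, -, h⟩ := h
    exact ih h

theorem liftsTo_map {a b : C} (l : K.Walk a b) : LiftsTo p (l.map p) a b := by
  induction l with
  | nil => exact ⟨rfl, rfl⟩
  | cons h l ih => exact ⟨rfl, _, h, ih⟩

theorem liftsTo_append {x y z : V} {q : G.Walk x y} {q' : G.Walk y z} {a b : C} :
    LiftsTo p (q.append q') a b ↔ ∃ m, LiftsTo p q a m ∧ LiftsTo p q' m b := by
  induction q generalizing a with
  | nil =>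
    refine ⟨fun h => ⟨a, ⟨h.map_start, rfl⟩, h⟩, ?_⟩
    rintro ⟨m, ⟨-, rfl⟩, h⟩
    exact h
  | cons e q ih =>
    simp only [Walk.cons_append, LiftsTo, ih]
    constructor
    · rintro ⟨ha, m, hm, n, hn, h⟩
      exact ⟨n, ⟨ha, m, hm, hn⟩, h⟩
    · rintro ⟨n, ⟨ha, m, hm, hn⟩, h⟩
      exact ⟨ha, m, hm, n, hn, h⟩

theorem LiftsTo.reverse {y z : V} {q : G.Walk y z} {a b : C} (h : LiftsTo p q a b) :
    LiftsTo p q.reverse b a := by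
  induction q generalizing a with
  | nil =>
    obtain ⟨ha, rfl⟩ := h
    exact ⟨ha, rfl⟩
  | cons e q ih =>
    obtain ⟨ha, m, hm, h⟩ := h
    rw [Walk.reverse_cons, liftsTo_append]
    exact ⟨m, ih h, h.map_start, a, hm.symm, ha, rfl⟩

theorem IsCovering.exists_liftsTo (hp : IsCovering p) {y z : V} (q : G.Walk y z) {a : C}
    (ha : p a = y) : ∃ b, LiftsTo p q a b := by
  induction q generalizing a with
  | nil => exact ⟨a, ha, rfl⟩
  | @cons y v z e q ih =>
    have hv : v ∈ G.neighborSet (p a) := by rwa [ha]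
    obtain ⟨m, hm, hmv⟩ := (hp.bijOn a).surjOn hv
    obtain ⟨b, hb⟩ := ih hmv
    exact ⟨b, ha, m, hm, hb⟩

theorem IsCovering.liftsTo_right_unique (hp : IsCovering p) {y z : V} {q : G.Walk y z}
    {a b b' : C} (h : LiftsTo p q a b) (h' : LiftsTo p q a b') : b = b' := by
  induction q generalizing a with
  | nil => exact h.2.symm.trans h'.2
  | cons e q ih =>
    obtain ⟨-, m, hm, h⟩ := h
    obtain ⟨-, m', hm', h'⟩ := h'
    obtain rfl := (hp.bijOn a).injOn hm hm' (h.map_start.trans h'.map_start.symm)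
    exact ih h h'

theorem IsCovering.liftsTo_left_unique (hp : IsCovering p) {y z : V} {q : G.Walk y z}
    {a a' b : C} (h : LiftsTo p q a b) (h' : LiftsTo p q a' b) : a = a' :=
  hp.liftsTo_right_unique h.reverse h'.reverse

theorem IsCovering.eq_of_liftsTo_backtrack (hp : IsCovering p) {u v : V} (e : G.Adj u v)
    {a b : C} (h : LiftsTo p (.cons e (.cons e.symm .nil)) a b) : a = b := by
  obtain ⟨ha, m, hm, -, n, hn, hb, rfl⟩ := h
  exact (hp.bijOn m).injOn hm.symm hn (ha.trans hb.symm)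

/-- It suffices to treat one elementary reduction, where local injectivity at the midpoint makes the
lift of the backtrack return to its start. -/
theorem IsCovering.liftsTo_of_homotopic (hp : IsCovering p) {y z : V} {q q' : G.Walk y z}
    (hq : Homotopic q q') {a b : C} : LiftsTo p q a b ↔ LiftsTo p q' a b := by
  induction hq with
  | rel q q' h =>
    cases h with
    | backtrack s e t =>
      rw [show s.append (.cons e (.cons e.symm t)) =
        s.append ((Walk.cons e (.cons e.symm .nil)).append t) from rfl]
      simp only [liftsTo_append (q := s), liftsTo_append (q' := t)]
      constructor
      · rintro ⟨m, hs, n, hmn, ht⟩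
        obtain rfl := hp.eq_of_liftsTo_backtrack e hmn
        exact ⟨m, hs, ht⟩
      · rintro ⟨m, hs, ht⟩
        obtain ⟨n, hmn⟩ := hp.exists_liftsTo (.cons e (.cons e.symm .nil)) hs.map_end
        obtain rfl := hp.eq_of_liftsTo_backtrack e hmn
        exact ⟨m, hs, m, hmn, ht⟩
  | refl => rfl
  | symm _ _ _ ih => exact ih.symm
  | trans _ _ _ _ _ ih ih' => exact ih.trans ih'

/-! ### Closed walks with non-closed lifts to the local covering -/

/-- Cycles of length at most `r` have only closed lifts to the `r`-local covering. -/
theorem IsLocalCovering.eq_of_liftsTo {r : ℕ} (hp : IsLocalCovering r p) {y : V}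
    {q : G.Walk y y} (hq : q.IsCycle) (hr : q.length ≤ r) {a b : C} (h : LiftsTo p q a b) :
    a = b := by
  obtain ⟨c, hc⟩ := hp.range_eq
  obtain rfl := h.map_start
  obtain ⟨m⟩ := hp.connected.preconnected c a
  -- The subgroup is known only at the base point `c`; conjugating by the projection of `m` carries
  -- `q` there.
  have hmem : FundGroup.mk ((m.map p).append (q.append (m.map p).reverse)) ∈
      localSubgroup G r (p c) :=
    Subgroup.subset_closure ⟨_, _, q, hq, hr, ⟨m.map p, rfl⟩, rfl⟩
  rw [← hc] at hmem
  obtain ⟨⟨l⟩, hl⟩ := hmem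
  have hom : Homotopic (l.map p) ((m.map p).append (q.append (m.map p).reverse)) :=
    Quotient.exact (s := homotopySetoid G (p c)) hl
  -- The conjugate lifts to a closed walk at `c`. By unique lifting its last piece runs from `b` to
  -- `c`, but it lifts the same walk as the reverse of `m`, which runs from `a` to `c`.
  have hW := (hp.isCovering.liftsTo_of_homotopic hom).mp (liftsTo_map l)
  obtain ⟨a', ha', hW⟩ := liftsTo_append.mp hW
  obtain rfl := hp.isCovering.liftsTo_right_unique ha' (liftsTo_map m)
  obtain ⟨b', hb', hW⟩ := liftsTo_append.mp hW
  obtain rfl := hp.isCovering.liftsTo_right_unique hb' h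
  exact hp.isCovering.liftsTo_left_unique (liftsTo_map m).reverse hW

/-- A closed walk with a lift that is not closed can be shortened along a chord. -/
theorem IsCovering.exists_shorter_of_chord (hp : IsCovering p) {x u v : V} (e : G.Adj u v)
    (s : G.Walk x u) (c : G.Walk u v) (t : G.Walk v x)
    (he : s(u, v) ∉ (s.append (c.append t)).edges) {a b : C} (hab : a ≠ b)
    (h : LiftsTo p (s.append (c.append t)) a b) :
    ∃ (x' : V) (q : G.Walk x' x') (a' b' : C), a' ≠ b' ∧ LiftsTo p q a' b' ∧
      q.length < (s.append (c.append t)).length := by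
  simp only [Walk.edges_append, List.mem_append, not_or] at he
  obtain ⟨hes, hec, het⟩ := he
  simp only [Walk.length_append]
  -- Both arcs between the ends of the chord have at least two edges, as the chord is not an edge of
  -- the walk. Hence replacing either arc by the chord shortens the walk.
  have hc : 2 ≤ c.length := by
    rcases c with _ | ⟨e', _ | ⟨e'', c⟩⟩
    · exact absurd rfl e.ne
    · simp at hec
    · simp
  have hst : 2 ≤ s.length + t.length := by
    rcases s with _ | ⟨e', _ | ⟨e'', s⟩⟩
    · rcases t with _ | ⟨e', _ | ⟨e'', t⟩⟩
      · exact absurd rfl e.ne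
      · simp [Sym2.eq_swap] at het
      · simp
    · rcases t with _ | ⟨e'', t⟩
      · simp [Sym2.eq_swap] at hes
      · simp; omega
    · simp; omega
  obtain ⟨m, hs, h⟩ := liftsTo_append.mp h
  obtain ⟨n, hc', ht⟩ := liftsTo_append.mp h
  obtain ⟨m', hm'⟩ := hp.exists_liftsTo (.cons e.symm .nil) hc'.map_end
  -- The chord is lifted from `n`. If this lift ends at `m`, it can replace the lift of `c` without
  -- moving the ends `a` and `b`; otherwise `c` closed up by the chord has a non-closed lift.
  by_cases hmm : m = m'
  · subst hmm
    refine ⟨x, s.append (.cons e t), a, b, hab, liftsTo_append.mpr ⟨m, hs, hs.map_end, n, ?_, ht⟩,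
      by simp; omega⟩
    obtain ⟨-, k, hk, -, rfl⟩ := hm'
    exact hk.symm
  · exact ⟨u, c.append (.cons e.symm .nil), m, m', hmm, liftsTo_append.mpr ⟨n, hc', hm'⟩,
      by simp; omega⟩

/-- A closed walk with a lift to the `r`-local covering that is not closed is at least as long as
some induced cycle that is longer than `r`. -/
theorem IsLocalCovering.minLongInducedCycle_le {r : ℕ} (hp : IsLocalCovering r p) {x : V}
    (q : G.Walk x x) {a b : C} (hab : a ≠ b) (h : LiftsTo p q a b) :
    minLongInducedCycle G r ≤ q.length := by
  induction hn : q.length using Nat.strong_induction_on generalizing x a b with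
  | h n ih =>
  subst hn
  have shorter : (∃ (x' : V) (q' : G.Walk x' x') (a' b' : C), a' ≠ b' ∧ LiftsTo p q' a' b' ∧
      q'.length < q.length) → minLongInducedCycle G r ≤ q.length := by
    rintro ⟨x', q', a', b', hab', h', hlt⟩
    exact (ih _ hlt q' hab' h' rfl).trans (by exact_mod_cast hlt.le)
  by_cases hq : q.IsCycle
  · by_cases hch : q.IsChordless
    · have hr : r < q.length := by
        by_contra hr
        exact hab (hp.eq_of_liftsTo hq (not_lt.mp hr) h)
      exact iInf_le_of_le x (iInf_le_of_le q (iInf_le _ ⟨hq, hch, hr⟩))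
    · refine shorter ?_
      rw [Walk.isChordless_iff_forall_mem_edges] at hch
      push Not at hch
      obtain ⟨u, v, hu, hv, e, he⟩ := hch
      rcases exists_eq_append_append_of_mem_support hu hv with ⟨s, c, t, rfl⟩ | ⟨s, c, t, rfl⟩
      · exact hp.isCovering.exists_shorter_of_chord e s c t he hab h
      · exact hp.isCovering.exists_shorter_of_chord e.symm s c t (by rwa [Sym2.eq_swap]) hab h
  · rcases eq_nil_or_backtrack_or_exists_of_not_isCycle hq with
      rfl | ⟨v, e, rfl⟩ | ⟨u, s, c, t, rfl, hc, hst⟩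
    · exact absurd h.2 hab
    · exact absurd (hp.isCovering.eq_of_liftsTo_backtrack e h) hab
    · refine shorter ?_
      obtain ⟨m, hs, h⟩ := liftsTo_append.mp h
      obtain ⟨n, hmn, ht⟩ := liftsTo_append.mp h
      -- If `c` lifts to a closed walk, deleting it keeps the ends `a` and `b`; otherwise `c` itself
      -- is the shorter walk.
      by_cases hmn' : m = n
      · subst hmn'
        exact ⟨x, s.append t, a, b, hab, liftsTo_append.mpr ⟨m, hs, ht⟩, by simp; omega⟩
      · exact ⟨u, c, m, n, hmn', hmn, by simp; omega⟩

end Lifting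

end LocalCov

theorem mainTheorem11 {V : Type*} {G : SimpleGraph V} (hG : G.Connected) (r : ℕ)
    {C : Type*} {K : SimpleGraph C} (p : K →g G) (hp : LocalCov.IsLocalCovering r p) :
    LocalCov.minLongInducedCycle G r ≤ LocalCov.displacement p := by
  refine le_iInf fun u => le_iInf fun v => le_iInf fun ⟨huv, hpuv⟩ => ?_
  obtain ⟨l, hl⟩ := hp.connected.exists_walk_length_eq_edist u v
  have h : LocalCov.LiftsTo p ((l.map p).copy rfl hpuv.symm) u v := by
    -- The end vertex is generalized so that the equation in `copy` can be eliminated.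
    have key : ∀ {z : V} (hz : p v = z), LocalCov.LiftsTo p ((l.map p).copy rfl hz) u v := by
      rintro _ rfl
      exact LocalCov.liftsTo_map l
    exact key hpuv.symm
  simpa [hl] using hp.minLongInducedCycle_le _ huv h
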